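/- Let $R$ be a commutative artinian ring and let $A$ be an artin $R$-algebra, i.e. an $R$-algebra that is finitely generated as an $R$-module. Modules are left $A$-modules, not necessarily finitely generated. A module is Gorenstein-projective if it is isomorphic to $\operatorname{Ker}(P^0\to P^1)$ for some acyclic complex $P^\bullet$ of projective $A$-modules, indexed by $\mathbb Z$, such that $\operatorname{Hom}_A(P^\bullet,Q)$ is acyclic for every projective $A$-module $Q$. A proper Gorenstein-projective resolution of a module $M$ is an exact sequence $\cdots\to G^{-1}\to G^0\to M\to 0$ with every $G^{-i}$ Gorenstein-projective that remains exact under $\operatorname{Hom}_A(G,-)$ for every Gorenstein-projective module $G$. Over an artin algebra every module $M$ has such a resolution $G^\bullet\to M$, and it is unique up to homotopy; put $\operatorname{Ext}^n_{\mathrm{GP}}(M,N)=H^n(\operatorname{Hom}_A(G^\bullet,N))$ and $$\mathrm{GP.dim}\,M=\sup\{n\ge 0 \mid \operatorname{Ext}^n_{\mathrm{GP}}(M,N)\neq 0 \text{ for some } A\text{-module } N\}\in\{0,1,2,\dots\}\cup\{\infty\},$$ where $\sup\emptyset=0$. Theorem. Let $M$ be an $A$-module and let $n\ge 0$ be an integer.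 The following are equivalent: 1. $\mathrm{GP.dim}\,M\le n$; 2. there exists an exact sequence $0\to G^{-n}\to\cdots\to G^{-1}\to G^0\to M\to 0$ with each $G^{-i}$ Gorenstein-projective; 3. for each exact sequence $0\to K\to G^{1-n}\to\cdots\to G^{-1}\to G^0\to M\to 0$ with each $G^{-i}$ Gorenstein-projective, the module $K$ is Gorenstein-projective (for $n=0$ the sequence reads $0\to K\to M\to 0$). -/

import Mathlib

universe w u

noncomputable section

namespace GorensteinProj

open CategoryTheory CategoryTheory.Limits

variable {A : Type u} [Ring A]

/-- The complex of abelian groups `Hom_A(K, Q)`, with `Hom_A(K i, Q)` placed in degree `i` and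
differentials given by precomposition with the differentials of `K` (so the direction of the
differentials is reversed). -/
def homInto {ι : Type} {c : ComplexShape ι} (K : HomologicalComplex (ModuleCat.{u} A) c)
    (Q : ModuleCat.{u} A) : HomologicalComplex AddCommGrpCat.{u} c.symm :=
  ((preadditiveYoneda.obj Q).mapHomologicalComplex c.symm).obj K.op

/-- The complex of abelian groups `Hom_A(G, K)`, with `Hom_A(G, K i)` placed in degree `i` and
differentials given by postcomposition with the differentials of `K`. -/
def homFrom {ι : Type} {c : ComplexShape ι} (G : ModuleCat.{u} A)
    (K : HomologicalComplex (ModuleCat.{u} A) c) : HomologicalComplex AddCommGrpCat.{u} c :=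
  ((preadditiveCoyoneda.obj (Opposite.op G)).mapHomologicalComplex c).obj K

/-- A totally acyclic complex of projective modules: an acyclic complex `P` of (not necessarily
finitely generated) projective modules such that `Hom_A(P, Q)` is acyclic for every projective
module `Q`. -/
structure IsTotallyAcyclic (P : CochainComplex (ModuleCat.{u} A) ℤ) : Prop where
  projective : ∀ i : ℤ, Module.Projective A (P.X i)
  acyclic : P.Acyclic
  hom_acyclic : ∀ Q : ModuleCat.{u} A, Module.Projective A Q → (homInto P Q).Acyclic

/-- A (large) Gorenstein-projective module: a module isomorphic to the zeroth cocycle module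
`Ker (d : P^0 ⟶ P^1)` of a totally acyclic complex. -/
def IsGorensteinProjective (M : ModuleCat.{u} A) : Prop :=
  ∃ P : CochainComplex (ModuleCat.{u} A) ℤ, IsTotallyAcyclic P ∧ Nonempty (M ≅ P.cycles 0)

/-- An exact sequence `⋯ ⟶ X 2 ⟶ X 1 ⟶ X 0 ⟶ M ⟶ 0` of modules. -/
structure LeftResolution (M : ModuleCat.{u} A) where
  complex : ChainComplex (ModuleCat.{u} A) ℕ
  ε : complex.X 0 ⟶ M
  w : complex.d 1 0 ≫ ε = 0
  acyclic : (complex.augment ε w).Acyclic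

/-- The complex `⋯ ⟶ X 2 ⟶ X 1 ⟶ X 0 ⟶ M ⟶ 0`, with `M` in degree `0`. -/
def LeftResolution.augmented {M : ModuleCat.{u} A} (E : LeftResolution M) :
    ChainComplex (ModuleCat.{u} A) ℕ :=
  E.complex.augment E.ε E.w

/-- A proper Gorenstein-projective resolution `⋯ ⟶ G 1 ⟶ G 0 ⟶ M ⟶ 0`: all `G i` are
Gorenstein-projective and the whole sequence (including `M`) stays acyclic under `Hom_A(G, -)` for
every Gorenstein-projective `G`. -/
structure LeftResolution.IsProperGP {M : ModuleCat.{u} A} (E : LeftResolution M) : Prop where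
  gorensteinProjective : ∀ i : ℕ, IsGorensteinProjective (E.complex.X i)
  hom_acyclic : ∀ G : ModuleCat.{u} A, IsGorensteinProjective G → (homFrom G E.augmented).Acyclic

/-- The `n`-th GP-extension group `Ext_GP^n(M, N) = H^n(Hom_A(G, N))` computed from a proper
Gorenstein-projective resolution `G ⟶ M`. (By the comparison theorem it does not depend on the
resolution, up to isomorphism.) -/
def gpExt {M : ModuleCat.{u} A} (E : LeftResolution M) (N : ModuleCat.{u} A) (n : ℕ) :
    AddCommGrpCat.{u} :=
  (homInto E.complex N).homology n

open Classical in
/-- The Gorenstein-projective dimension `sup {n ≥ 0 | Ext_GP^n(M, -) ≠ 0}` of `M`, as an extended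
natural number, where `Ext_GP` is computed from a proper Gorenstein-projective resolution of `M`.
Over an artin algebra every module has such a resolution, so that the second branch, for a module
without one, does not occur there. -/
def gpDim (M : ModuleCat.{u} A) : ℕ∞ :=
  if h : ∃ E : LeftResolution M, E.IsProperGP then
    sSup {k : ℕ∞ | ∃ n : ℕ, k = n ∧ ∃ N : ModuleCat.{u} A, ¬ IsZero (gpExt h.choose N n)}
  else ⊤

end GorensteinProj

end

/-! Everything is compared with `GPLength n M`, the existence of a Gorenstein-projective resolution
of length at most `n`.

Gorenstein-projectives are the largest class of modules without positive extensions to projectives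
whose members embed in a projective with cokernel in the class. This coinductive description gives
closure under extensions, kernels of epimorphisms and direct summands. A Schanuel argument
(`GPLength.syzygy`) then shows that `GPLength n M` holds exactly when the `n`-th syzygy in any given
Gorenstein-projective resolution is Gorenstein-projective, which links conditions 2 and 3.

For condition 1, take a proper resolution. If the `n`-th syzygy is Gorenstein-projective, so are the
later ones, properness splits the sequences between them, and `Ext_GP` vanishes above `n`.
Conversely, if `Ext_GP` vanishes in degree `n + 1`, testing it on the `(n + 1)`-st syzygy exhibits
the `n`-th as a direct summand of a Gorenstein-projective.

Since `gpDim` is `⊤` without a proper resolution, one must be built when `GPLength n M` holds. The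
Auslander–Buchweitz approximation `0 → T → G → M → 0`, with `T` of finite projective dimension,
begins it, and a projective resolution of `T` completes it. -/

noncomputable section

namespace GorensteinProj

open CategoryTheory CategoryTheory.Limits

variable {A : Type u} [Ring A]

/-! ### Short exact sequences: pushouts, pullbacks, compositions -/

/-- There is a short exact sequence `0 ⟶ X ⟶ Y ⟶ Z ⟶ 0`. -/
def Conf (X Y Z : ModuleCat.{u} A) : Prop :=
  ∃ (f : X →ₗ[A] Y) (g : Y →ₗ[A] Z),
    Function.Injective f ∧ Function.Exact f g ∧ Function.Surjective g

theorem conf_of_shortExact {S : ShortComplex (ModuleCat.{u} A)} (hS : S.ShortExact) :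
    Conf S.X₁ S.X₂ S.X₃ :=
  ⟨S.f.hom, S.g.hom, hS.moduleCat_injective_f,
    (ShortComplex.ShortExact.moduleCat_exact_iff_function_exact S).1 hS.exact,
    hS.moduleCat_surjective_g⟩

theorem Conf.exists_shortExact {X Y Z : ModuleCat.{u} A} (h : Conf X Y Z) :
    ∃ (f : X ⟶ Y) (g : Y ⟶ Z) (w : f ≫ g = 0), (ShortComplex.mk f g w).ShortExact := by
  obtain ⟨f, g, hf, hfg, hg⟩ := h
  have w : ModuleCat.ofHom f ≫ ModuleCat.ofHom g = 0 := by
    ext x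
    exact hfg.apply_apply_eq_zero x
  refine ⟨ModuleCat.ofHom f, ModuleCat.ofHom g, w, ?_⟩
  exact
    { exact := (ShortComplex.ShortExact.moduleCat_exact_iff_function_exact _).2 hfg
      mono_f := (ModuleCat.mono_iff_injective _).2 hf
      epi_g := (ModuleCat.epi_iff_surjective _).2 hg }

theorem Conf.congr_left {X X' Y Z : ModuleCat.{u} A} (h : Conf X Y Z) (e : X' ≃ₗ[A] X) :
    Conf X' Y Z := by
  obtain ⟨f, g, hf, hfg, hg⟩ := h
  refine ⟨f ∘ₗ e, g, hf.comp e.injective, fun y => ?_, hg⟩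
  rw [hfg y]
  simp [e.surjective.exists]

theorem Conf.congr_right {X Y Z Z' : ModuleCat.{u} A} (h : Conf X Y Z) (e : Z ≃ₗ[A] Z') :
    Conf X Y Z' := by
  obtain ⟨f, g, hf, hfg, hg⟩ := h
  refine ⟨f, e ∘ₗ g, hf, fun y => ?_, e.surjective.comp hg⟩
  simpa using hfg y

theorem conf_of_injective {X Y : ModuleCat.{u} A} (f : X →ₗ[A] Y) (hf : Function.Injective f) :
    Conf X Y (ModuleCat.of A (Y ⧸ LinearMap.range f)) :=
  ⟨f, (LinearMap.range f).mkQ, hf, LinearMap.exact_map_mkQ_range f,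
    Submodule.mkQ_surjective _⟩

theorem conf_of_surjective {Y Z : ModuleCat.{u} A} (g : Y →ₗ[A] Z) (hg : Function.Surjective g) :
    Conf (ModuleCat.of A (LinearMap.ker g)) Y Z :=
  ⟨(LinearMap.ker g).subtype, g, Subtype.val_injective, LinearMap.exact_subtype_ker_map g, hg⟩

theorem conf_prod (X Y : ModuleCat.{u} A) : Conf X (ModuleCat.of A (X × Y)) Y :=
  ⟨LinearMap.inl A X Y, LinearMap.snd A X Y, LinearMap.inl_injective, .inl_snd,
    LinearMap.snd_surjective⟩

theorem Conf.prod {X Y Z X' Y' Z' : ModuleCat.{u} A} (h : Conf X Y Z) (h' : Conf X' Y' Z') :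
    Conf (ModuleCat.of A (X × X')) (ModuleCat.of A (Y × Y')) (ModuleCat.of A (Z × Z')) := by
  obtain ⟨f, g, hf, hfg, hg⟩ := h
  obtain ⟨f', g', hf', hfg', hg'⟩ := h'
  refine ⟨f.prodMap f', g.prodMap g', hf.prodMap hf', ?_, hg.prodMap hg'⟩
  rintro ⟨a, b⟩
  have := hfg a
  have := hfg' b
  simp_all [Prod.ext_iff]

theorem conf_refl (X : ModuleCat.{u} A) (Y : ModuleCat.{u} A) [Subsingleton Y] : Conf X X Y :=
  ⟨LinearMap.id, 0, Function.injective_id, fun _ => by simp, fun y => ⟨0, Subsingleton.elim _ _⟩⟩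

theorem conf_zero_left (X : ModuleCat.{u} A) (Y : ModuleCat.{u} A) [Subsingleton Y] :
    Conf Y X X :=
  ⟨0, LinearMap.id, Function.injective_of_subsingleton _,
    fun x => by simp [eq_comm], Function.surjective_id⟩

/-- The pushout of two monomorphisms with a common source. -/
theorem Conf.pushout {K G M W C : ModuleCat.{u} A} (h : Conf K G M) (h' : Conf K W C) :
    ∃ L, Conf G L C ∧ Conf W L M := by
  obtain ⟨i, p, hi, hip, hp⟩ := h
  obtain ⟨j, q, hj, hjq, hq⟩ := h'
  let r : K →ₗ[A] G × W := i.prod (-j)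
  have hr (a : G) (b : W) :
      (LinearMap.range r).mkQ (a, b) = 0 ↔ ∃ k, i k = a ∧ -j k = b := by
    simp [r]
  have hL (l : (G × W) ⧸ LinearMap.range r) : ∃ a b, l = (LinearMap.range r).mkQ (a, b) := by
    obtain ⟨⟨a, b⟩, rfl⟩ := Submodule.mkQ_surjective _ l
    exact ⟨a, b, rfl⟩
  have hle₁ : LinearMap.range r ≤ LinearMap.ker (q ∘ₗ LinearMap.snd A G W) := by
    rintro _ ⟨k, rfl⟩
    simp [r, hjq.apply_apply_eq_zero]
  have hle₂ : LinearMap.range r ≤ LinearMap.ker (p ∘ₗ LinearMap.fst A G W) := by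
    rintro _ ⟨k, rfl⟩
    simp [r, hip.apply_apply_eq_zero]
  refine ⟨ModuleCat.of A ((G × W) ⧸ LinearMap.range r),
    ⟨(LinearMap.range r).mkQ ∘ₗ LinearMap.inl A G W,
      (LinearMap.range r).liftQ _ hle₁, ?_, ?_, ?_⟩,
    ⟨(LinearMap.range r).mkQ ∘ₗ LinearMap.inr A G W,
      (LinearMap.range r).liftQ _ hle₂, ?_, ?_, ?_⟩⟩
  · refine (injective_iff_map_eq_zero _).2 fun a ha => ?_
    obtain ⟨k, rfl, hk⟩ := (hr a 0).1 ha
    rw [neg_eq_zero, map_eq_zero_iff _ hj] at hk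
    simp [hk]
  · intro l
    obtain ⟨a, b, rfl⟩ := hL l
    constructor
    · intro hb
      obtain ⟨k, hk⟩ := (hjq b).1 hb
      refine ⟨a + i k, ?_⟩
      refine sub_eq_zero.1 ?_
      rw [LinearMap.comp_apply, ← map_sub]
      exact (hr _ _).2 ⟨k, by simp, by simp [hk]⟩
    · rintro ⟨a', ha'⟩
      rw [← ha']
      simp
  · intro c
    obtain ⟨b, rfl⟩ := hq c
    exact ⟨(LinearMap.range r).mkQ (0, b), by simp⟩
  · refine (injective_iff_map_eq_zero _).2 fun b hb => ?_
    obtain ⟨k, hk, rfl⟩ := (hr 0 b).1 hb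
    rw [map_eq_zero_iff _ hi] at hk
    simp [hk]
  · intro l
    obtain ⟨a, b, rfl⟩ := hL l
    constructor
    · intro ha
      obtain ⟨k, hk⟩ := (hip a).1 ha
      refine ⟨b + j k, ?_⟩
      refine sub_eq_zero.1 ?_
      rw [LinearMap.comp_apply, ← map_sub]
      exact (hr _ _).2 ⟨-k, by simp [hk], by simp⟩
    · rintro ⟨a', ha'⟩
      rw [← ha']
      simp
  · intro c
    obtain ⟨b, rfl⟩ := hp c
    exact ⟨(LinearMap.range r).mkQ (b, 0), by simp⟩

/-- The pullback of two epimorphisms with a common target. -/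
theorem Conf.pullback {K G M K' G' : ModuleCat.{u} A} (h : Conf K G M) (h' : Conf K' G' M) :
    ∃ L, Conf K L G' ∧ Conf K' L G := by
  obtain ⟨i, p, hi, hip, hp⟩ := h
  obtain ⟨j, q, hj, hjq, hq⟩ := h'
  let r : G × G' →ₗ[A] M := p ∘ₗ LinearMap.fst A G G' - q ∘ₗ LinearMap.snd A G G'
  have hr (x : G × G') : x ∈ LinearMap.ker r ↔ p x.1 = q x.2 := by
    simp [r, sub_eq_zero]
  refine ⟨ModuleCat.of A (LinearMap.ker r),
    ⟨(LinearMap.inl A G G' ∘ₗ i).codRestrict _ fun k => ?_,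
      LinearMap.snd A G G' ∘ₗ (LinearMap.ker r).subtype, ?_, ?_, ?_⟩,
    ⟨(LinearMap.inr A G G' ∘ₗ j).codRestrict _ fun k => ?_,
      LinearMap.fst A G G' ∘ₗ (LinearMap.ker r).subtype, ?_, ?_, ?_⟩⟩
  · simp [hr, hip.apply_apply_eq_zero]
  · intro a b hab
    exact hi (congrArg (fun x : LinearMap.ker r => x.1.1) hab)
  · rintro ⟨⟨a, b⟩, hab⟩
    have hab' := (hr _).1 hab
    constructor
    · rintro (rfl : b = 0)
      obtain ⟨k, hk⟩ := (hip a).1 (by simpa using hab')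
      exact ⟨k, Subtype.ext (Prod.ext hk rfl)⟩
    · rintro ⟨k, hk⟩
      exact (congrArg (fun x : LinearMap.ker r => x.1.2) hk).symm
  · intro b
    obtain ⟨a, ha⟩ := hp (q b)
    exact ⟨⟨(a, b), (hr _).2 ha⟩, rfl⟩
  · simp [hr, hjq.apply_apply_eq_zero]
  · intro a b hab
    exact hj (congrArg (fun x : LinearMap.ker r => x.1.2) hab)
  · rintro ⟨⟨a, b⟩, hab⟩
    have hab' := (hr _).1 hab
    constructor
    · rintro (rfl : a = 0)
      obtain ⟨k, hk⟩ := (hjq b).1 (by simpa using hab'.symm)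
      exact ⟨k, Subtype.ext (Prod.ext rfl hk)⟩
    · rintro ⟨k, hk⟩
      exact (congrArg (fun x : LinearMap.ker r => x.1.1) hk).symm
  · intro a
    obtain ⟨b, hb⟩ := hq (p a)
    exact ⟨⟨(a, b), (hr _).2 hb.symm⟩, rfl⟩

/-- The cokernel of a composition of monomorphisms. -/
theorem Conf.comp_mono {K G G' P G₁ : ModuleCat.{u} A} (h : Conf K G G') (h' : Conf G P G₁) :
    ∃ W, Conf K P W ∧ Conf G' W G₁ := by
  obtain ⟨i, p, hi, hip, hp⟩ := h
  obtain ⟨j, q, hj, hjq, hq⟩ := h'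
  have hji : Function.Injective (j ∘ₗ i) := hj.comp hi
  have hle : LinearMap.range (j ∘ₗ i) ≤ LinearMap.ker q := by
    rintro _ ⟨k, rfl⟩
    exact hjq.apply_apply_eq_zero _
  have hker (a b : G) : p a = p b ↔ (LinearMap.range (j ∘ₗ i)).mkQ (j a) =
      (LinearMap.range (j ∘ₗ i)).mkQ (j b) := by
    rw [← sub_eq_zero, ← map_sub, hip, ← sub_eq_zero, ← map_sub, ← map_sub]
    simp [hj.eq_iff, -map_sub]
  -- `s` is only a set-theoretic section; by `hker` the induced map to the cokernel does not depend
  -- on it and is linear.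
  choose s hs using hp
  let φ : G' →ₗ[A] P ⧸ LinearMap.range (j ∘ₗ i) :=
    { toFun := fun x => (LinearMap.range (j ∘ₗ i)).mkQ (j (s x))
      map_add' := fun x y => by
        rw [← map_add, ← map_add, ← hker, map_add, hs, hs, hs]
      map_smul' := fun c x => by
        rw [← map_smul, ← map_smul, ← hker, RingHom.id_apply, map_smul, hs, hs] }
  have hφ (a : G) : φ (p a) = (LinearMap.range (j ∘ₗ i)).mkQ (j a) :=
    (hker _ _).1 (hs _)
  refine ⟨_, conf_of_injective (j ∘ₗ i) hji, φ, (LinearMap.range (j ∘ₗ i)).liftQ q hle, ?_, ?_, ?_⟩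
  · intro x y hxy
    rw [← hs x, ← hs y, hφ, hφ] at hxy
    rw [← hs x, ← hs y]
    exact (hker _ _).2 hxy
  · intro l
    obtain ⟨a, rfl⟩ := Submodule.mkQ_surjective _ l
    constructor
    · intro ha
      obtain ⟨b, rfl⟩ := (hjq a).1 ha
      exact ⟨p b, hφ b⟩
    · rintro ⟨x, hx⟩
      rw [← hx, ← hs x, hφ]
      exact hjq.apply_apply_eq_zero _
  · intro c
    obtain ⟨b, rfl⟩ := hq c
    exact ⟨(LinearMap.range (j ∘ₗ i)).mkQ b, rfl⟩

/-- The kernel of a composition of epimorphisms. -/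
theorem Conf.comp_epi {K L G' K₀ G₀ : ModuleCat.{u} A} (h : Conf K L G') (h' : Conf K₀ G₀ L) :
    ∃ G₁, Conf G₁ G₀ G' ∧ Conf K₀ G₁ K := by
  obtain ⟨i, p, hi, hip, hp⟩ := h
  obtain ⟨j, q, hj, hjq, hq⟩ := h'
  have hmem (x : LinearMap.ker (p ∘ₗ q)) : q x ∈ LinearMap.range i :=
    (hip _).1 x.2
  let e := LinearEquiv.ofInjective i hi
  refine ⟨_, conf_of_surjective (p ∘ₗ q) (hp.comp hq),
    j.codRestrict _ fun k => ?_,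
    e.symm.toLinearMap ∘ₗ (q ∘ₗ (LinearMap.ker (p ∘ₗ q)).subtype).codRestrict _ hmem, ?_, ?_, ?_⟩
  · simp [hjq.apply_apply_eq_zero]
  · intro a b hab
    exact hj (congrArg Subtype.val hab)
  · rintro ⟨x, hx⟩
    rw [LinearMap.comp_apply, LinearEquiv.coe_coe, map_eq_zero_iff _ e.symm.injective]
    exact (Subtype.ext_iff.trans (hjq x)).trans
      ⟨fun ⟨k, h⟩ => ⟨k, Subtype.ext h⟩, fun ⟨k, h⟩ => ⟨k, congrArg Subtype.val h⟩⟩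
  · intro k
    obtain ⟨x, hx⟩ := hq (i k)
    refine ⟨⟨x, ?_⟩, ?_⟩
    · rw [LinearMap.mem_ker, LinearMap.comp_apply, hx, hip.apply_apply_eq_zero]
    · rw [LinearMap.comp_apply, LinearEquiv.coe_coe, LinearEquiv.symm_apply_eq]
      exact Subtype.ext hx

/-- A retraction of the left map of a short exact sequence decomposes the middle term. -/
theorem nonempty_prod_equiv_of_retraction {X Y Z : ModuleCat.{u} A} {f : X →ₗ[A] Y} {g : Y →ₗ[A] Z}
    (hfg : Function.Exact f g) (hg : Function.Surjective g) (r : Y →ₗ[A] X)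
    (hr : r ∘ₗ f = LinearMap.id) : Nonempty (Y ≃ₗ[A] X × Z) := by
  refine ⟨LinearEquiv.ofBijective (r.prod g) ⟨?_, ?_⟩⟩
  · refine (injective_iff_map_eq_zero _).2 fun y hy => ?_
    obtain ⟨h₁, h₂⟩ := Prod.ext_iff.1 hy
    obtain ⟨x, rfl⟩ := (hfg y).1 h₂
    have : x = 0 := (LinearMap.congr_fun hr x).symm.trans h₁
    simp [this]
  · rintro ⟨x, z⟩
    obtain ⟨y, rfl⟩ := hg z
    refine ⟨y + f (x - r y), Prod.ext ?_ ?_⟩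
    · have := LinearMap.congr_fun hr (x - r y)
      simp only [LinearMap.comp_apply, LinearMap.id_apply] at this
      change r (y + f (x - r y)) = x
      rw [map_add, this, add_sub_cancel]
    · change g (y + f (x - r y)) = g y
      rw [map_add, hfg.apply_apply_eq_zero, add_zero]

/-! ### Vanishing of Ext and dimension shifting -/

open Abelian

instance (Q : ModuleCat.{u} A) [Module.Projective A Q] : CategoryTheory.Projective Q :=
  (IsProjective.iff_projective Q).1 inferInstance

/-- The vanishing of `Ext^n(X, Y)`. -/
def ExtVanish (X Y : ModuleCat.{u} A) (n : ℕ) : Prop := Subsingleton (Ext X Y n)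

section ExtVanish

variable {X Y Z Q : ModuleCat.{u} A} {n : ℕ}

theorem extVanish_of_projective (P Y : ModuleCat.{u} A) [Module.Projective A P] (n : ℕ) :
    ExtVanish P Y (n + 1) :=
  Ext.subsingleton_of_projective P Y n

theorem ExtVanish.middle (h : Conf X Y Z) (hX : ExtVanish X Q n) (hZ : ExtVanish Z Q n) :
    ExtVanish Y Q n := by
  obtain ⟨f, g, w, hS⟩ := h.exists_shortExact
  refine subsingleton_of_forall_eq 0 fun e => ?_
  obtain ⟨e', rfl⟩ := Ext.contravariant_sequence_exact₂ hS _ e (hX.elim _ _)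
  rw [hZ.elim e' 0, Ext.comp_zero]

theorem ExtVanish.left (h : Conf X Y Z) (hY : ExtVanish Y Q n) (hZ : ExtVanish Z Q (n + 1)) :
    ExtVanish X Q n := by
  obtain ⟨f, g, w, hS⟩ := h.exists_shortExact
  refine subsingleton_of_forall_eq 0 fun e => ?_
  obtain ⟨e', rfl⟩ := Ext.contravariant_sequence_exact₁ hS _ e (add_comm 1 n) (hZ.elim _ _)
  rw [hY.elim e' 0, Ext.comp_zero]

theorem ExtVanish.right (h : Conf X Y Z) (hX : ExtVanish X Q n) (hY : ExtVanish Y Q (n + 1)) :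
    ExtVanish Z Q (n + 1) := by
  obtain ⟨f, g, w, hS⟩ := h.exists_shortExact
  refine subsingleton_of_forall_eq 0 fun e => ?_
  obtain ⟨e', rfl⟩ := Ext.contravariant_sequence_exact₃ hS _ e (hY.elim _ _) (add_comm 1 n)
  rw [hX.elim e' 0, Ext.comp_zero]

theorem ExtVanish.target_right (h : Conf X Y Z) (hY : ExtVanish Q Y n)
    (hX : ExtVanish Q X (n + 1)) : ExtVanish Q Z n := by
  obtain ⟨f, g, w, hS⟩ := h.exists_shortExact
  refine subsingleton_of_forall_eq 0 fun e => ?_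
  obtain ⟨e', rfl⟩ := Ext.covariant_sequence_exact₃ _ hS e rfl (hX.elim _ _)
  rw [hY.elim e' 0, Ext.zero_comp]

theorem ExtVanish.of_retract (hY : ExtVanish Y Q n) (i : X ⟶ Y) (r : Y ⟶ X) (h : i ≫ r = 𝟙 X) :
    ExtVanish X Q n := by
  refine subsingleton_of_forall_eq 0 fun e => ?_
  have : (Ext.mk₀ i).comp ((Ext.mk₀ r).comp e (zero_add n)) (zero_add n) = e := by
    rw [Ext.mk₀_comp_mk₀_assoc, h, Ext.mk₀_id_comp]
  rw [← this, hY.elim ((Ext.mk₀ r).comp e (zero_add n)) 0, Ext.comp_zero]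

theorem ExtVanish.congr (hY : ExtVanish Y Q n) (e : X ≅ Y) : ExtVanish X Q n :=
  hY.of_retract e.hom e.inv e.hom_inv_id

theorem ExtVanish.exists_extension {f : X ⟶ Y} {g : Y ⟶ Z} {w : f ≫ g = 0}
    (hS : (ShortComplex.mk f g w).ShortExact) (hZ : ExtVanish Z Q 1) (φ : X ⟶ Q) :
    ∃ ψ : Y ⟶ Q, f ≫ ψ = φ := by
  obtain ⟨e, he⟩ := Ext.contravariant_sequence_exact₁ hS _ (Ext.mk₀ φ) (add_zero 1) (hZ.elim _ _)
  obtain ⟨ψ, rfl⟩ := Ext.mk₀_bijective _ _ |>.2 e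
  rw [Ext.mk₀_comp_mk₀] at he
  exact ⟨ψ, (Ext.mk₀_bijective _ _).1 he⟩

/-- As `Ext¹(Y, Q) = 0`, the connecting map makes `Ext¹(Z, Q)` the cokernel of restriction `Hom(Y,
Q) → Hom(X, Q)`. -/
theorem extVanish_one_of_exists_extension {f : X ⟶ Y} {g : Y ⟶ Z} {w : f ≫ g = 0}
    (hS : (ShortComplex.mk f g w).ShortExact) (hY : ExtVanish Y Q 1)
    (h : ∀ φ : X ⟶ Q, ∃ ψ : Y ⟶ Q, f ≫ ψ = φ) : ExtVanish Z Q 1 := by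
  refine subsingleton_of_forall_eq 0 fun e => ?_
  obtain ⟨e', rfl⟩ := Ext.contravariant_sequence_exact₃ hS _ e (hY.elim _ _) (add_zero 1)
  obtain ⟨φ, rfl⟩ := Ext.mk₀_bijective _ _ |>.2 e'
  obtain ⟨ψ, rfl⟩ := h φ
  rw [← Ext.mk₀_comp_mk₀, ← Ext.comp_assoc_of_second_deg_zero, hS.extClass_comp, Ext.zero_comp]

theorem ExtVanish.exists_lift {f : X ⟶ Y} {g : Y ⟶ Z} {w : f ≫ g = 0}
    (hS : (ShortComplex.mk f g w).ShortExact) (hX : ExtVanish Q X 1) (φ : Q ⟶ Z) :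
    ∃ ψ : Q ⟶ Y, ψ ≫ g = φ := by
  obtain ⟨e, he⟩ := Ext.covariant_sequence_exact₃ _ hS (Ext.mk₀ φ) (zero_add 1) (hX.elim _ _)
  obtain ⟨ψ, rfl⟩ := Ext.mk₀_bijective _ _ |>.2 e
  rw [Ext.mk₀_comp_mk₀] at he
  exact ⟨ψ, (Ext.mk₀_bijective _ _).1 he⟩

theorem Conf.nonempty_prod_equiv (h : Conf X Y Z) (hZ : ExtVanish Z X 1) :
    Nonempty (Y ≃ₗ[A] X × Z) := by
  obtain ⟨f, g, w, hS⟩ := h.exists_shortExact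
  obtain ⟨r, hr⟩ := hZ.exists_extension hS (𝟙 X)
  exact nonempty_prod_equiv_of_retraction
    ((ShortComplex.ShortExact.moduleCat_exact_iff_function_exact _).1 hS.exact)
    hS.moduleCat_surjective_g r.hom (congrArg ModuleCat.Hom.hom hr)

end ExtVanish

/-- All positive extension groups from `X` to projective modules vanish. -/
def Perp (X : ModuleCat.{u} A) : Prop :=
  ∀ Q : ModuleCat.{u} A, Module.Projective A Q → ∀ n : ℕ, ExtVanish X Q (n + 1)

section Perp

variable {X Y Z : ModuleCat.{u} A}

theorem perp_of_projective (P : ModuleCat.{u} A) [Module.Projective A P] : Perp P :=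
  fun Q _ n => extVanish_of_projective P Q n

theorem Perp.middle (h : Conf X Y Z) (hX : Perp X) (hZ : Perp Z) : Perp Y :=
  fun Q hQ n => .middle h (hX Q hQ n) (hZ Q hQ n)

theorem Perp.left (h : Conf X Y Z) (hY : Perp Y) (hZ : Perp Z) : Perp X :=
  fun Q hQ n => .left h (hY Q hQ n) (hZ Q hQ (n + 1))

theorem Perp.congr (hY : Perp Y) (e : X ≅ Y) : Perp X :=
  fun Q hQ n => (hY Q hQ n).congr e

theorem Perp.of_prod (h : Perp (ModuleCat.of A (X × Y))) : Perp X :=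
  fun Q hQ n => (h Q hQ n).of_retract (ModuleCat.ofHom (LinearMap.inl A X Y))
    (ModuleCat.ofHom (LinearMap.fst A X Y)) rfl

end Perp

/-! ### Cycles and Hom complexes -/

section Complexes

variable {ι : Type} {c : ComplexShape ι}

theorem shortExact_cycles (K : HomologicalComplex (ModuleCat.{u} A) c) {i j : ι} (hij : c.Rel i j)
    (hK : K.ExactAt j) (w : K.iCycles i ≫ K.toCycles i j = 0) :
    (ShortComplex.mk (K.iCycles i) (K.toCycles i j) w).ShortExact := by
  have hepi : Epi (K.toCycles i j) := by
    obtain rfl := c.prev_eq' hij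
    have h := (K.sc j).exact_iff_epi_toCycles.1 hK
    have : K.toCycles (c.prev j) j = (K.sc j).toCycles :=
      (cancel_mono (K.iCycles j)).1 ((K.toCycles_i _ _).trans (K.sc j).toCycles_i.symm)
    rw [this]
    exact h
  have hk : (ShortComplex.mk (K.iCycles i) (K.d i j) (K.iCycles_d i j)).Exact :=
    ShortComplex.exact_of_f_is_kernel _ (K.cyclesIsKernel i j (c.next_eq' hij))
  -- The inclusion of cycles in the third place is mono, so exactness transfers from the kernel
  -- sequence of `d`.
  let φ : ShortComplex.mk (K.iCycles i) (K.toCycles i j) w ⟶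
      ShortComplex.mk (K.iCycles i) (K.d i j) (K.iCycles_d i j) :=
    { τ₁ := 𝟙 _
      τ₂ := 𝟙 _
      τ₃ := K.iCycles j }
  have : Epi φ.τ₁ := inferInstanceAs (Epi (𝟙 _))
  have : IsIso φ.τ₂ := inferInstanceAs (IsIso (𝟙 _))
  have : Mono φ.τ₃ := inferInstanceAs (Mono (K.iCycles j))
  exact
    { exact := (ShortComplex.exact_iff_of_epi_of_isIso_of_mono φ).2 hk
      mono_f := inferInstanceAs (Mono (K.iCycles i))
      epi_g := hepi }

theorem iCycles_toCycles (K : HomologicalComplex (ModuleCat.{u} A) c) (i j : ι) :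
    K.iCycles i ≫ K.toCycles i j = 0 := by
  rw [← cancel_mono (K.iCycles j), Category.assoc, K.toCycles_i, K.iCycles_d, zero_comp]

theorem conf_cycles (K : HomologicalComplex (ModuleCat.{u} A) c) {i j : ι} (hij : c.Rel i j)
    (hK : K.ExactAt j) : Conf (K.cycles i) (K.X i) (K.cycles j) :=
  conf_of_shortExact (shortExact_cycles K hij hK (iCycles_toCycles K i j))

theorem homInto_exactAt_iff (K : HomologicalComplex (ModuleCat.{u} A) c) (Q : ModuleCat.{u} A)
    {i j k : ι} (hij : c.prev j = i) (hjk : c.next j = k) :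
    (homInto K Q).ExactAt j ↔
      ∀ f : K.X j ⟶ Q, K.d i j ≫ f = 0 → ∃ g : K.X k ⟶ Q, K.d j k ≫ g = f := by
  rw [HomologicalComplex.exactAt_iff' (homInto K Q) k j i hjk hij, ShortComplex.ab_exact_iff]
  rfl

theorem homFrom_exactAt_iff (K : HomologicalComplex (ModuleCat.{u} A) c) (G : ModuleCat.{u} A)
    {i j k : ι} (hij : c.prev j = i) (hjk : c.next j = k) :
    (homFrom G K).ExactAt j ↔
      ∀ f : G ⟶ K.X j, f ≫ K.d j k = 0 → ∃ g : G ⟶ K.X i, g ≫ K.d i j = f := by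
  rw [HomologicalComplex.exactAt_iff' (homFrom G K) i j k hij hjk, ShortComplex.ab_exact_iff]
  rfl

theorem exact_epi_comp {X Y Z P : ModuleCat.{u} A} {f : X ⟶ Y} {g : Y ⟶ Z} {w : f ≫ g = 0}
    (h : (ShortComplex.mk f g w).Exact) (e : P ⟶ X) [Epi e] (w' : (e ≫ f) ≫ g = 0) :
    (ShortComplex.mk (e ≫ f) g w').Exact := by
  let φ : ShortComplex.mk (e ≫ f) g w' ⟶ ShortComplex.mk f g w :=
    { τ₁ := e, τ₂ := 𝟙 _, τ₃ := 𝟙 _ }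
  have : Epi φ.τ₁ := inferInstanceAs (Epi e)
  have : IsIso φ.τ₂ := inferInstanceAs (IsIso (𝟙 _))
  have : Mono φ.τ₃ := inferInstanceAs (Mono (𝟙 _))
  exact (ShortComplex.exact_iff_of_epi_of_isIso_of_mono φ).2 h

theorem exact_comp_mono {X Y Z P : ModuleCat.{u} A} {f : X ⟶ Y} {g : Y ⟶ Z} {w : f ≫ g = 0}
    (h : (ShortComplex.mk f g w).Exact) (m : Z ⟶ P) [Mono m] (w' : f ≫ g ≫ m = 0) :
    (ShortComplex.mk f (g ≫ m) w').Exact := by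
  let φ : ShortComplex.mk f g w ⟶ ShortComplex.mk f (g ≫ m) w' :=
    { τ₁ := 𝟙 _, τ₂ := 𝟙 _, τ₃ := m }
  have : Epi φ.τ₁ := inferInstanceAs (Epi (𝟙 _))
  have : IsIso φ.τ₂ := inferInstanceAs (IsIso (𝟙 _))
  have : Mono φ.τ₃ := inferInstanceAs (Mono m)
  exact (ShortComplex.exact_iff_of_epi_of_isIso_of_mono φ).1 h

end Complexes

/-! ### Coinductive characterization of Gorenstein-projectives -/

/-- Glues a forward orbit in `p` to a backward orbit in `q` at `a`. Two predicates are needed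
because syzygies to the left are only known to lie in `Perp`. -/
theorem exists_int_chain {α : Type*} (r : α → α → Prop) (p q : α → Prop)
    (hp : ∀ a, p a → ∃ b, p b ∧ r a b) (hq : ∀ a, q a → ∃ b, q b ∧ r b a) (a : α)
    (hpa : p a) (hqa : q a) :
    ∃ f : ℤ → α, f 0 = a ∧ (∀ i, r (f i) (f (i + 1))) ∧ ∀ i, p (f i) ∨ q (f i) := by
  choose! s hs using hp
  choose! t ht using hq
  have hs' (n : ℕ) : p (s^[n] a) := by
    induction n with
    | zero => exact hpa
    | succ n ih => rw [Function.iterate_succ_apply']; exact (hs _ ih).1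
  have ht' (n : ℕ) : q (t^[n] a) := by
    induction n with
    | zero => exact hqa
    | succ n ih => rw [Function.iterate_succ_apply']; exact (ht _ ih).1
  let f : ℤ → α
    | Int.ofNat n => s^[n] a
    | Int.negSucc n => t^[n + 1] a
  refine ⟨f, rfl, ?_, ?_⟩
  · rintro (n | _ | n)
    · change r (s^[n] a) (s^[n + 1] a)
      rw [Function.iterate_succ_apply']
      exact (hs _ (hs' n)).2
    · exact (ht _ hqa).2
    · change r (t^[n + 2] a) (t^[n + 1] a)
      rw [Function.iterate_succ_apply' t (n + 1)]
      exact (ht _ (ht' (n + 1))).2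
  · rintro (n | n)
    · exact .inl (hs' n)
    · exact .inr (ht' (n + 1))

theorem exists_conf_projective (M : ModuleCat.{u} A) :
    ∃ K P : ModuleCat.{u} A, Module.Projective A P ∧ Conf K P M :=
  ⟨_, ModuleCat.of A (M →₀ A), inferInstanceAs (Module.Projective A (M →₀ A)),
    conf_of_surjective (Finsupp.linearCombination A id)
      (Finsupp.linearCombination_id_surjective A M)⟩

/-- The complex obtained by splicing short exact sequences `0 ⟶ X i ⟶ P i ⟶ X (i + 1) ⟶ 0`
of modules with vanishing extensions to projective modules is totally acyclic. -/
theorem isGorensteinProjective_of_int_chain (X : ℤ → ModuleCat.{u} A) (hX : ∀ i, Perp (X i))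
    (h : ∀ i, ∃ P : ModuleCat.{u} A, Module.Projective A P ∧ Conf (X i) P (X (i + 1))) :
    IsGorensteinProjective (X 0) := by
  choose P hP hconf using h
  choose f g w hS using fun i => (hconf i).exists_shortExact
  have hf (i : ℤ) : Mono (f i) := (hS i).mono_f
  have hg (i : ℤ) : Epi (g i) := (hS i).epi_g
  let K : CochainComplex (ModuleCat.{u} A) ℤ :=
    CochainComplex.of P (fun i => g i ≫ f (i + 1)) fun i => by
      rw [Category.assoc, reassoc_of% (w (i + 1)), zero_comp, comp_zero]
  have hd (i : ℤ) : K.d i (i + 1) = g i ≫ f (i + 1) :=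
    CochainComplex.of_d P (fun i => g i ≫ f (i + 1)) i
  have hprev (i : ℤ) : (ComplexShape.up ℤ).prev (i + 1) = i :=
    (ComplexShape.up ℤ).prev_eq' rfl
  have hnext (i : ℤ) : (ComplexShape.up ℤ).next i = i + 1 :=
    (ComplexShape.up ℤ).next_eq' rfl
  refine ⟨K, ⟨hP, ?_, ?_⟩, ?_⟩
  · intro i
    obtain ⟨i, rfl⟩ : ∃ j, i = j + 1 := ⟨i - 1, by ring⟩
    rw [K.exactAt_iff' i (i + 1) (i + 1 + 1) (hprev i) (hnext _)]
    have := exact_comp_mono (exact_epi_comp (hS (i + 1)).exact (g i)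
      (by rw [Category.assoc, w, comp_zero])) (f (i + 1 + 1))
      (by rw [Category.assoc, reassoc_of% (w (i + 1)), zero_comp, comp_zero])
    convert this using 1
    simp only [HomologicalComplex.sc', HomologicalComplex.shortComplexFunctor']
    congr 1 <;> exact hd _
  · intro Q hQ i
    obtain ⟨i, rfl⟩ : ∃ j, i = j + 1 := ⟨i - 1, by ring⟩
    rw [homInto_exactAt_iff K Q (hprev i) (hnext _)]
    intro φ hφ
    rw [hd, Category.assoc, ← comp_zero (f := g i), cancel_epi] at hφ
    -- A cocycle kills the image of `f (i + 1)`, so it descends to `X (i + 1 + 1)`; it then extends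
    -- to the next projective because `Ext¹` from the cokernel vanishes.
    obtain ⟨ψ, rfl⟩ := (hS (i + 1)).exact.desc' φ hφ
    obtain ⟨θ, rfl⟩ := ExtVanish.exists_extension (hS (i + 1 + 1)) (hX _ Q hQ 0) ψ
    exact ⟨θ, by rw [hd]; exact Category.assoc _ _ _⟩
  · have hex : (ShortComplex.mk (f 0) (K.d 0 1)
        (by rw [show K.d 0 1 = _ from hd 0, reassoc_of% (w 0), zero_comp])).Exact := by
      have := exact_comp_mono (hS 0).exact (f (0 + 1))
        (by rw [reassoc_of% (w 0), zero_comp])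
      convert this using 1
      congr 1
    exact ⟨IsLimit.conePointUniqueUpToIso hex.fIsKernel (K.cyclesIsKernel 0 1 (hnext 0))⟩

/-- The class of Gorenstein-projective modules is the largest class of modules `X` without
extensions to projective modules which embed in a projective module with cokernel in the class. -/
theorem isGorensteinProjective_of_coinduction (S : ModuleCat.{u} A → Prop)
    (hS : ∀ X, S X → Perp X)
    (h : ∀ X, S X → ∃ P X' : ModuleCat.{u} A, Module.Projective A P ∧ S X' ∧ Conf X P X')
    {X : ModuleCat.{u} A} (hX : S X) : IsGorensteinProjective X := by
  obtain ⟨F, rfl, hF, hF'⟩ := exists_int_chain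
    (fun X X' => ∃ P : ModuleCat.{u} A, Module.Projective A P ∧ Conf X P X') S Perp
    (fun X hX => by
      obtain ⟨P, X', hP, hX', hc⟩ := h X hX
      exact ⟨X', hX', P, hP, hc⟩)
    (fun X hX => by
      obtain ⟨K, P, hP, hc⟩ := exists_conf_projective X
      exact ⟨K, .left hc (perp_of_projective P) hX, P, hP, hc⟩) X hX (hS X hX)
  exact isGorensteinProjective_of_int_chain F (fun i => (hF' i).elim (hS _) id) hF

/-- Acyclicity of `Hom(P, Q)` says that maps from a cycle module to `Q` extend to the projective
containing it, so `Ext¹` of the next cycle module vanishes. Higher degrees follow by shifting down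
the complex. -/
theorem IsTotallyAcyclic.perp_cycles {P : CochainComplex (ModuleCat.{u} A) ℤ}
    (hP : IsTotallyAcyclic P) (i : ℤ) : Perp (P.cycles i) := by
  intro Q hQ n
  have hprev (i : ℤ) : (ComplexShape.up ℤ).prev (i + 1) = i :=
    (ComplexShape.up ℤ).prev_eq' rfl
  have hnext (i : ℤ) : (ComplexShape.up ℤ).next i = i + 1 :=
    (ComplexShape.up ℤ).next_eq' rfl
  have hproj := hP.projective
  induction n generalizing i with
  | zero =>
    obtain ⟨i, rfl⟩ : ∃ j, i = j + 1 + 1 + 1 := ⟨i - 1 - 1 - 1, by ring⟩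
    have h₀ := shortExact_cycles P (i := i + 1) (j := i + 1 + 1) rfl (hP.acyclic _)
      (iCycles_toCycles P _ _)
    have h₁ := shortExact_cycles P (i := i + 1 + 1) (j := i + 1 + 1 + 1) rfl (hP.acyclic _)
      (iCycles_toCycles P _ _)
    have hepi : Epi (P.toCycles (i + 1) (i + 1 + 1)) := h₀.epi_g
    refine extVanish_one_of_exists_extension h₁ (extVanish_of_projective _ Q 0) fun φ => ?_
    obtain ⟨ψ, hψ⟩ := (homInto_exactAt_iff P Q (hprev i) (hnext _)).1 (hP.hom_acyclic Q hQ _)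
      (P.toCycles (i + 1) (i + 1 + 1) ≫ φ) (by
        rw [← Category.assoc, P.d_toCycles, zero_comp])
    refine ⟨ψ, ?_⟩
    rw [← cancel_epi (P.toCycles (i + 1) (i + 1 + 1)), ← hψ, ← Category.assoc, P.toCycles_i]
  | succ n ih =>
    obtain ⟨i, rfl⟩ : ∃ j, i = j + 1 := ⟨i - 1, by ring⟩
    exact .right (conf_cycles P (i := i) (j := i + 1) rfl (hP.acyclic _)) (ih i)
      (extVanish_of_projective _ Q _)

/-- The cycle modules of `P` together form a coinductive class, so no shift of the complex is
required. -/
theorem IsTotallyAcyclic.isGorensteinProjective_cycles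
    {P : CochainComplex (ModuleCat.{u} A) ℤ} (hP : IsTotallyAcyclic P) (i : ℤ) :
    IsGorensteinProjective (P.cycles i) :=
  isGorensteinProjective_of_coinduction (fun X => ∃ i, X = P.cycles i)
    (by rintro _ ⟨i, rfl⟩; exact hP.perp_cycles i)
    (by
      rintro _ ⟨i, rfl⟩
      exact ⟨P.X i, P.cycles (i + 1), hP.projective i, ⟨i + 1, rfl⟩,
        conf_cycles P rfl (hP.acyclic _)⟩) ⟨i, rfl⟩

/-! ### Closure properties of Gorenstein-projectives -/

section GorensteinProjective

variable {X Y Z : ModuleCat.{u} A}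

theorem IsGorensteinProjective.congr (h : IsGorensteinProjective Y) (e : X ≅ Y) :
    IsGorensteinProjective X := by
  obtain ⟨P, hP, ⟨e'⟩⟩ := h
  exact ⟨P, hP, ⟨e ≪≫ e'⟩⟩

theorem IsGorensteinProjective.perp (h : IsGorensteinProjective X) : Perp X := by
  obtain ⟨P, hP, ⟨e⟩⟩ := h
  exact (hP.perp_cycles 0).congr e

theorem IsGorensteinProjective.exists_conf (h : IsGorensteinProjective X) :
    ∃ P X' : ModuleCat.{u} A,
      Module.Projective A P ∧ IsGorensteinProjective X' ∧ Conf X P X' := by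
  obtain ⟨P, hP, ⟨e⟩⟩ := h
  exact ⟨P.X 0, P.cycles 1, hP.projective 0, hP.isGorensteinProjective_cycles 1,
    (conf_cycles P rfl (hP.acyclic _)).congr_left e.toLinearEquiv⟩

theorem IsGorensteinProjective.of_conf {P : ModuleCat.{u} A} [Module.Projective A P]
    (hc : Conf X P Y) (hX : Perp X) (hY : IsGorensteinProjective Y) :
    IsGorensteinProjective X := by
  refine isGorensteinProjective_of_coinduction (fun Z => Z = X ∨ IsGorensteinProjective Z)
    ?_ ?_ (.inl rfl)
  · rintro Z (rfl | hZ)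
    · exact hX
    · exact hZ.perp
  · rintro Z (rfl | hZ)
    · exact ⟨P, Y, inferInstance, .inr hY, hc⟩
    · obtain ⟨P, X', hP, hX', h⟩ := hZ.exists_conf
      exact ⟨P, X', hP, .inr hX', h⟩

theorem isGorensteinProjective_of_projective (P : ModuleCat.{u} A) [Module.Projective A P] :
    IsGorensteinProjective P := by
  refine isGorensteinProjective_of_coinduction (fun Z => Module.Projective A Z)
    (fun Z _ => perp_of_projective Z) (fun Z hZ => ?_) ‹_›
  exact ⟨Z, ModuleCat.of A PUnit, hZ, inferInstanceAs (Module.Projective A PUnit.{u + 1}),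
    conf_refl _ _⟩

/-- Gorenstein-projective modules are closed under extensions. -/
theorem IsGorensteinProjective.middle (hc : Conf X Y Z) (hX : IsGorensteinProjective X)
    (hZ : IsGorensteinProjective Z) : IsGorensteinProjective Y := by
  refine isGorensteinProjective_of_coinduction
    (fun Y => ∃ X Z : ModuleCat.{u} A,
      IsGorensteinProjective X ∧ IsGorensteinProjective Z ∧ Conf X Y Z)
    ?_ ?_ ⟨X, Z, hX, hZ, hc⟩
  · rintro Y ⟨X, Z, hX, hZ, hc⟩
    exact .middle hc hX.perp hZ.perp
  · rintro Y ⟨X, Z, hX, hZ, hc⟩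
    obtain ⟨P, X', hP, hX', hcX⟩ := hX.exists_conf
    obtain ⟨P', Z', hP', hZ', hcZ⟩ := hZ.exists_conf
    -- The pushout `L` is an extension of `Z` by `P`, hence splits. Then `Y ⊆ P × Z ⊆ P × P'`, and
    -- the total cokernel is an extension of `Z'` by `X'`.
    obtain ⟨L, hYL, hPL⟩ := Conf.pushout hc hcX
    obtain ⟨e⟩ := hPL.nonempty_prod_equiv (hZ.perp P hP 0)
    have h := ((conf_refl P (ModuleCat.of A PUnit)).prod hcZ).congr_right (Z' := Z')
      LinearEquiv.uniqueProd
    obtain ⟨W, hYW, hXW⟩ := Conf.comp_mono hYL (h.congr_left e)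
    exact ⟨_, W, inferInstanceAs (Module.Projective A (P × P')), ⟨X', Z', hX', hZ', hXW⟩, hYW⟩

/-- Gorenstein-projective modules are closed under kernels of epimorphisms. -/
theorem IsGorensteinProjective.left (hc : Conf X Y Z) (hY : IsGorensteinProjective Y)
    (hZ : IsGorensteinProjective Z) : IsGorensteinProjective X := by
  obtain ⟨P, Y', hP, hY', hcY⟩ := hY.exists_conf
  obtain ⟨W, hXW, hZW⟩ := Conf.comp_mono hc hcY
  exact .of_conf hXW (.left hc hY.perp hZ.perp) (.middle hZW hZ hY')

theorem IsGorensteinProjective.congr_equiv (h : IsGorensteinProjective Y) (e : X ≃ₗ[A] Y) :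
    IsGorensteinProjective X :=
  h.congr e.toModuleIso

/-- `C` is the cokernel of `X → X × Y → P`. A map `X → Q` extends to `P` by first composing with the
projection `X × Y → X` and then using `Ext¹(Z, Q) = 0`. -/
theorem Conf.exists_of_prod_left {P : ModuleCat.{u} A} [Module.Projective A P]
    (hc : Conf (ModuleCat.of A (X × Y)) P Z) (hZ : Perp Z) :
    ∃ C, Conf X P C ∧ ∀ Q : ModuleCat.{u} A, Module.Projective A Q → ExtVanish C Q 1 := by
  obtain ⟨f, g, w, hS⟩ := hc.exists_shortExact
  let i : X ⟶ ModuleCat.of A (X × Y) := ModuleCat.ofHom (LinearMap.inl A X Y)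
  let r : ModuleCat.of A (X × Y) ⟶ X := ModuleCat.ofHom (LinearMap.fst A X Y)
  have hir : i ≫ r = 𝟙 X := rfl
  have : Mono f := hS.mono_f
  have : Mono i := mono_of_mono_fac hir
  have hS' : (ShortComplex.mk (i ≫ f) (cokernel.π (i ≫ f)) (cokernel.condition _)).ShortExact :=
    { exact := ShortComplex.exact_cokernel _
      mono_f := inferInstanceAs (Mono (i ≫ f))
      epi_g := inferInstanceAs (Epi (cokernel.π (i ≫ f))) }
  refine ⟨_, conf_of_shortExact hS', fun Q hQ => ?_⟩
  refine extVanish_one_of_exists_extension hS' (extVanish_of_projective P Q 0) fun φ => ?_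
  obtain ⟨ψ, hψ⟩ := ExtVanish.exists_extension hS (hZ Q hQ 0) (r ≫ φ)
  exact ⟨ψ, by rw [Category.assoc, hψ, reassoc_of% hir]⟩

/-- Gorenstein-projective modules are closed under direct summands. -/
theorem IsGorensteinProjective.of_prod (h : IsGorensteinProjective (ModuleCat.of A (X × Y))) :
    IsGorensteinProjective X := by
  refine isGorensteinProjective_of_coinduction
    (fun X => ∃ Y : ModuleCat.{u} A, IsGorensteinProjective (ModuleCat.of A (X × Y)))
    ?_ ?_ ⟨Y, h⟩
  · rintro X ⟨Y, h⟩
    exact h.perp.of_prod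
  · rintro X ⟨Y, h⟩
    obtain ⟨P, Z, hP, hZ, hc⟩ := h.exists_conf
    obtain ⟨C, hC, hC'⟩ := hc.exists_of_prod_left hZ.perp
    obtain ⟨D, hD, hD'⟩ :=
      (hc.congr_left (LinearEquiv.prodComm A Y X)).exists_of_prod_left (X := Y) (Y := X) hZ.perp
    -- `L` is an extension of `Z` by `P × P`, so it is Gorenstein-projective, and an extension of `C
    -- × D` by `P`, which splits. Hence `D × P` is a complement witnessing that `C` stays in the
    -- class.
    obtain ⟨L, hL, hL'⟩ := Conf.pushout hc (hC.prod hD)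
    obtain ⟨e⟩ := hL.nonempty_prod_equiv (.middle (conf_prod C D) (hC' P hP) (hD' P hP))
    have hPP : IsGorensteinProjective (ModuleCat.of A (P × P)) :=
      have : Module.Projective A (ModuleCat.of A (P × P)) :=
        inferInstanceAs (Module.Projective A (P × P))
      isGorensteinProjective_of_projective _
    have hLG : IsGorensteinProjective L := .middle hL' hPP hZ
    refine ⟨P, C, hP, ⟨ModuleCat.of A (D × P), ?_⟩, hC⟩
    exact hLG.congr_equiv
      ((LinearEquiv.prodAssoc A C D P).symm ≪≫ₗ LinearEquiv.prodComm A (C × D) P ≪≫ₗ e.symm)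

end GorensteinProjective

/-! ### Finite resolutions and Auslander–Buchweitz approximation -/

/-- `M` has a resolution of length at most `n` by Gorenstein-projective modules. -/
def GPLength : ℕ → ModuleCat.{u} A → Prop
  | 0, M => IsGorensteinProjective M
  | n + 1, M => ∃ K G : ModuleCat.{u} A, IsGorensteinProjective G ∧ GPLength n K ∧ Conf K G M

/-- `M` has a resolution of length at most `n` by projective modules. -/
def ProjLength : ℕ → ModuleCat.{u} A → Prop
  | 0, M => Module.Projective A M
  | n + 1, M => ∃ K P : ModuleCat.{u} A, Module.Projective A P ∧ ProjLength n K ∧ Conf K P M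

section Length

variable {K G L M X Y Z : ModuleCat.{u} A} {n : ℕ}

theorem GPLength.congr (h : GPLength n Y) (e : X ≃ₗ[A] Y) : GPLength n X := by
  cases n with
  | zero => exact IsGorensteinProjective.congr_equiv h e
  | succ n =>
    obtain ⟨K, G, hG, hK, hc⟩ := h
    exact ⟨K, G, hG, hK, hc.congr_right e.symm⟩

theorem GPLength.left (hc : Conf X Y Z) (hY : GPLength n Y) (hZ : IsGorensteinProjective Z) :
    GPLength n X := by
  cases n with
  | zero => exact IsGorensteinProjective.left hc hY hZ
  | succ n =>
    obtain ⟨K, G, hG, hK, hc'⟩ := hY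
    obtain ⟨G₁, h₁, h₂⟩ := Conf.comp_epi hc hc'
    exact ⟨K, G₁, .left h₁ hG hZ, hK, h₂⟩

theorem GPLength.middle (hc : Conf X Y Z) (hX : GPLength n X) (hZ : IsGorensteinProjective Z) :
    GPLength n Y := by
  induction n generalizing X Y Z with
  | zero => exact IsGorensteinProjective.middle hc hX hZ
  | succ n ih =>
    obtain ⟨K, G, hG, hK, hcX⟩ := hX
    obtain ⟨Ω, P, hP, hcZ⟩ := exists_conf_projective Z
    have hPG := isGorensteinProjective_of_projective P
    -- The pullback splits as `X × P`, so `G × P` maps onto `Y`; the kernel is an extension of `Ω`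
    -- by `K`, to which induction applies.
    obtain ⟨Q, hQP, hQY⟩ := Conf.pullback hc hcZ
    obtain ⟨e⟩ := hQP.nonempty_prod_equiv (extVanish_of_projective P X 0)
    have h := ((hcX.prod (conf_zero_left P (ModuleCat.of A PUnit))).congr_left (X' := K)
      LinearEquiv.prodUnique.symm).congr_right (Z' := Q) e.symm
    obtain ⟨G₁, h₁, h₂⟩ := Conf.comp_epi hQY h
    exact ⟨G₁, _, .middle (conf_prod G P) hG hPG, ih h₂ hK (.left hcZ hPG hZ), h₁⟩

/-- The length of a Gorenstein-projective resolution can be computed from any first syzygy. -/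
theorem GPLength.syzygy (h : GPLength (n + 1) M) (hc : Conf K G M)
    (hG : IsGorensteinProjective G) : GPLength n K := by
  obtain ⟨K', G', hG', hK', hc'⟩ := h
  obtain ⟨L, hL, hL'⟩ := Conf.pullback hc hc'
  exact .left hL (.middle hL' hK' hG) hG'

/-- Pushing out `0 → K → G → M → 0` along a hull `K → W` makes the middle term an extension of
Gorenstein-projectives and the kernel `W`. -/
theorem GPLength.approximation_of_hull
    (hull : ∀ K : ModuleCat.{u} A, GPLength n K →
      ∃ W G : ModuleCat.{u} A, ProjLength n W ∧ IsGorensteinProjective G ∧ Conf K W G)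
    (h : GPLength (n + 1) M) :
    ∃ T G : ModuleCat.{u} A, ProjLength n T ∧ IsGorensteinProjective G ∧ Conf T G M := by
  obtain ⟨K, G, hG, hK, hc⟩ := h
  obtain ⟨W, G', hW, hG', hc'⟩ := hull K hK
  obtain ⟨L, h₁, h₂⟩ := Conf.pushout hc hc'
  exact ⟨W, L, hW, .middle h₁ hG hG', h₂⟩

theorem GPLength.exists_hull (h : GPLength n M) :
    ∃ W G : ModuleCat.{u} A, ProjLength n W ∧ IsGorensteinProjective G ∧ Conf M W G := by
  induction n generalizing M with
  | zero => exact h.exists_conf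
  | succ n ih =>
    obtain ⟨T, G, hT, hG, hc⟩ := GPLength.approximation_of_hull (fun K hK => ih hK) h
    obtain ⟨P, G', hP, hG', hc'⟩ := hG.exists_conf
    -- `W = P / T` contains `M = G / T` with cokernel `G'`, and has projective length one more than
    -- `T`.
    obtain ⟨W, h₁, h₂⟩ := Conf.comp_mono hc hc'
    exact ⟨W, G', ⟨T, P, hP, hT, h₁⟩, hG', h₂⟩

/-- A module of finite Gorenstein-projective dimension has a Gorenstein-projective approximation
whose kernel has finite projective dimension. -/
theorem GPLength.exists_approximation (h : GPLength (n + 1) M) :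
    ∃ T G : ModuleCat.{u} A, ProjLength n T ∧ IsGorensteinProjective G ∧ Conf T G M :=
  GPLength.approximation_of_hull (fun _ hK => hK.exists_hull) h

/-- Dimension shifting along a finite projective resolution. This makes approximations with kernel
`K` proper. -/
theorem ProjLength.extVanish (hK : ProjLength n K) (hG : IsGorensteinProjective G) (i : ℕ) :
    ExtVanish G K (i + 1) := by
  induction n generalizing K i with
  | zero => exact hG.perp K hK i
  | succ n ih =>
    obtain ⟨K', P, hP, hK', hc⟩ := hK
    exact .target_right hc (hG.perp P hP i) (ih hK' (i + 1))

end Length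

/-! ### Construction of proper resolutions -/

theorem exactAt_zero_iff (C : ChainComplex (ModuleCat.{u} A) ℕ) :
    C.ExactAt 0 ↔ Epi (C.d 1 0) := by
  rw [C.exactAt_iff' 1 0 0 (by simp) (by simp),
    ShortComplex.exact_iff_epi _ (C.shape 0 0 (by simp))]
  rfl

theorem exactAt_succ_iff (C : ChainComplex (ModuleCat.{u} A) ℕ) (i : ℕ) :
    C.ExactAt (i + 1) ↔
      (ShortComplex.mk (C.d (i + 2) (i + 1)) (C.d (i + 1) i) (C.d_comp_d _ _ _)).Exact :=
  C.exactAt_iff' (i + 2) (i + 1) i (by simp) (by simp)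

namespace LeftResolution

variable {K G M : ModuleCat.{u} A}

/-- The zero complex as a resolution of a zero module. -/
def zero (M : ModuleCat.{u} A) (hM : IsZero M) : LeftResolution M where
  complex := (HasZeroObject.zero' (ChainComplex (ModuleCat.{u} A) ℕ)).zero
  ε := 0
  w := comp_zero
  acyclic i := ShortComplex.exact_of_isZero_X₂ _ <| by
    cases i with
    | zero => exact hM
    | succ i => exact (HomologicalComplex.eval _ _ i).map_isZero (isZero_zero _)

theorem isZero_zero_X (hM : IsZero M) (i : ℕ) : IsZero ((zero M hM).complex.X i) :=
  (HomologicalComplex.eval _ _ i).map_isZero (isZero_zero _)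

theorem zero_isProperGP (hM : IsZero M) : (zero M hM).IsProperGP where
  gorensteinProjective i := by
    have h := isZero_zero_X hM i
    have := ModuleCat.subsingleton_of_isZero h
    exact isGorensteinProjective_of_projective _
  hom_acyclic G _ i := by
    rw [homFrom_exactAt_iff _ G rfl rfl]
    intro f _
    have h : IsZero ((zero M hM).augmented.X i) := by
      cases i with
      | zero => exact hM
      | succ i => exact isZero_zero_X hM i
    exact ⟨0, h.eq_of_tgt _ _⟩

variable {f : K ⟶ G} {g : G ⟶ M} {w : f ≫ g = 0}

/-- Extend a resolution of `K` by a short exact sequence `0 ⟶ K ⟶ G ⟶ M ⟶ 0`. -/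
def splice (E : LeftResolution K) (hS : (ShortComplex.mk f g w).ShortExact) :
    LeftResolution M where
  complex := E.complex.augment (E.ε ≫ f) (by rw [reassoc_of% E.w, zero_comp])
  ε := g
  w := show (E.ε ≫ f) ≫ g = 0 by rw [Category.assoc, w, comp_zero]
  acyclic i := by
    have : Epi E.ε := (exactAt_zero_iff _).1 (E.acyclic 0)
    have : Mono f := hS.mono_f
    -- In the augmented complex `M`, `G` and the first term of `E` sit in degrees 0, 1, 2; from
    -- degree 3 on it is that of `E` shifted by one.
    match i with
    | 0 => exact (exactAt_zero_iff _).2 hS.epi_g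
    | 1 =>
      rw [exactAt_succ_iff]
      exact exact_epi_comp hS.exact E.ε (by rw [Category.assoc, w, comp_zero])
    | 2 =>
      rw [exactAt_succ_iff]
      exact exact_comp_mono (w := E.w) ((exactAt_succ_iff _ 0).1 (E.acyclic 1)) f
        (by rw [reassoc_of% E.w, zero_comp])
    | i + 3 =>
      have h := (exactAt_succ_iff _ (i + 1)).1 (E.acyclic (i + 2))
      exact (exactAt_succ_iff _ (i + 2)).2 h

/-- Vanishing of `Ext¹(H, K)` lets maps from `H` lift along `G → M`, so `Hom(H, -)` preserves the
spliced exactness. -/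
theorem IsProperGP.splice {E : LeftResolution K} (hE : E.IsProperGP)
    (hS : (ShortComplex.mk f g w).ShortExact) (hG : IsGorensteinProjective G)
    (hlift : ∀ H : ModuleCat.{u} A, IsGorensteinProjective H → ExtVanish H K 1) :
    (E.splice hS).IsProperGP where
  gorensteinProjective i := by
    cases i with
    | zero => exact hG
    | succ i => exact hE.gorensteinProjective i
  hom_acyclic H hH i := by
    have : Mono f := hS.mono_f
    have hE' := hE.hom_acyclic H hH
    match i with
    | 0 =>
      rw [homFrom_exactAt_iff (j := 0) (i := 1) (k := 0) _ H (by simp) (by simp)]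
      intro φ _
      exact (hlift H hH).exists_lift hS φ
    | 1 =>
      rw [homFrom_exactAt_iff (j := 1) (i := 2) (k := 0) _ H (by simp) (by simp)]
      intro φ hφ
      obtain ⟨ψ, rfl⟩ := hS.exact.lift' φ hφ
      obtain ⟨θ, hθ⟩ := (homFrom_exactAt_iff (j := 0) (i := 1) (k := 0) _ H (by simp)
        (by simp)).1 (hE' 0) ψ (by rw [HomologicalComplex.shape _ _ _ (by simp)]; exact comp_zero)
      exact ⟨θ, by rw [← hθ]; exact (Category.assoc _ _ _).symm⟩
    | 2 =>
      rw [homFrom_exactAt_iff (j := 2) (i := 3) (k := 1) _ H (by simp) (by simp)]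
      intro φ hφ
      refine (homFrom_exactAt_iff (j := 1) (i := 2) (k := 0) _ H (by simp)
        (by simp)).1 (hE' 1) φ ?_
      have h (θ : H ⟶ K) (hθ : θ ≫ f = 0) : θ = 0 := zero_of_comp_mono f hθ
      exact h _ ((Category.assoc _ _ _).trans hφ)
    | i + 3 =>
      rw [homFrom_exactAt_iff (j := i + 3) (i := i + 4) (k := i + 2) _ H (by simp) (by simp)]
      exact (homFrom_exactAt_iff (j := i + 2) (i := i + 3) (k := i + 1) _ H (by simp)
        (by simp)).1 (hE' (i + 2))

theorem exists_isProperGP_of_conf (hK : ∃ E : LeftResolution K, E.IsProperGP)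
    (hc : Conf K G M) (hG : IsGorensteinProjective G)
    (hlift : ∀ H : ModuleCat.{u} A, IsGorensteinProjective H → ExtVanish H K 1) :
    ∃ E : LeftResolution M, E.IsProperGP := by
  obtain ⟨E, hE⟩ := hK
  obtain ⟨f, g, w, hS⟩ := hc.exists_shortExact
  exact ⟨E.splice hS, hE.splice hS hG hlift⟩

theorem exists_isProperGP_of_isGorensteinProjective (hM : IsGorensteinProjective M) :
    ∃ E : LeftResolution M, E.IsProperGP := by
  have : Module.Projective A (ModuleCat.of A PUnit.{u + 1}) :=
    inferInstanceAs (Module.Projective A PUnit.{u + 1})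
  exact exists_isProperGP_of_conf
    ⟨_, zero_isProperGP (M := ModuleCat.of A PUnit) (ModuleCat.isZero_of_subsingleton _)⟩
    (conf_zero_left M (ModuleCat.of A PUnit)) hM fun H hH => hH.perp _ this 0

theorem exists_isProperGP_of_projLength {n : ℕ} (hM : ProjLength n M) :
    ∃ E : LeftResolution M, E.IsProperGP := by
  induction n generalizing M with
  | zero =>
    have : Module.Projective A M := hM
    exact exists_isProperGP_of_isGorensteinProjective (isGorensteinProjective_of_projective M)
  | succ n ih =>
    obtain ⟨K, P, hP, hK, hc⟩ := hM
    exact exists_isProperGP_of_conf (ih hK) hc (isGorensteinProjective_of_projective P)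
      fun H hH => hK.extVanish hH 0

theorem exists_isProperGP_of_gpLength {n : ℕ} (hM : GPLength n M) :
    ∃ E : LeftResolution M, E.IsProperGP := by
  cases n with
  | zero => exact exists_isProperGP_of_isGorensteinProjective hM
  | succ n =>
    obtain ⟨T, G, hT, hG, hc⟩ := hM.exists_approximation
    exact exists_isProperGP_of_conf (exists_isProperGP_of_projLength hT) hc hG
      fun H hH => hT.extVanish hH 0

/-- Truncating a projective resolution leaves the `n`-th syzygy in position `n`; this is the test
sequence for passing from condition 3 to 2. -/
theorem exists_projective_truncation (M : ModuleCat.{u} A) (n : ℕ) :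
    ∃ E : LeftResolution M, (∀ i < n, Module.Projective A (E.complex.X i)) ∧
      ∀ i > n, IsZero (E.complex.X i) := by
  induction n generalizing M with
  | zero =>
    obtain ⟨f, g, w, hS⟩ := (conf_zero_left M (ModuleCat.of A PUnit)).exists_shortExact
    have hZ : IsZero (ModuleCat.of A PUnit.{u + 1}) := ModuleCat.isZero_of_subsingleton _
    refine ⟨(zero _ hZ).splice hS, fun i hi => absurd hi i.not_lt_zero, fun i hi => ?_⟩
    obtain ⟨i, rfl⟩ := Nat.exists_eq_add_of_lt hi
    rw [Nat.zero_add]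
    exact isZero_zero_X hZ i
  | succ n ih =>
    obtain ⟨K, P, hP, hc⟩ := exists_conf_projective M
    obtain ⟨E, hE, hE'⟩ := ih K
    obtain ⟨f, g, w, hS⟩ := hc.exists_shortExact
    refine ⟨E.splice hS, fun i hi => ?_, fun i hi => ?_⟩
    · cases i with
      | zero => exact hP
      | succ i => exact hE i (by lia)
    · cases i with
      | zero => lia
      | succ i => exact hE' i (by lia)

/-! ### Syzygies and GP-extension groups -/

section Syzygies

variable (E : LeftResolution M)

/-- Augmentation shifts degrees by one, so `E.augmented.cycles i` is the `i`-th syzygy, covered by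
`E.complex.X i`. -/
theorem conf_cycles (i : ℕ) :
    Conf (E.augmented.cycles (i + 1)) (E.complex.X i) (E.augmented.cycles i) :=
  GorensteinProj.conf_cycles E.augmented (i := i + 1) (j := i) rfl (E.acyclic i)

/-- The zeroth cocycle module of the augmented complex is the resolved module. -/
theorem nonempty_cycles_zero_equiv : Nonempty (E.augmented.cycles 0 ≃ₗ[A] M) := by
  have := E.augmented.isIso_iCycles 0 0 (by simp) (E.augmented.shape _ _ (by simp))
  exact ⟨(asIso (E.augmented.iCycles 0)).toLinearEquiv⟩

theorem gpLength_cycles {n : ℕ} (i : ℕ)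
    (hn : IsGorensteinProjective (E.augmented.cycles (i + n)))
    (hX : ∀ j < n, IsGorensteinProjective (E.complex.X (i + j))) :
    GPLength n (E.augmented.cycles i) := by
  induction n generalizing i with
  | zero => exact hn
  | succ n ih =>
    refine ⟨_, _, hX 0 n.succ_pos, ih (i + 1) ?_ fun j hj => ?_, E.conf_cycles i⟩
    · rwa [add_assoc, add_comm 1]
    · rw [add_assoc, add_comm 1]
      exact hX (j + 1) (by lia)

theorem isGorensteinProjective_cycles {n : ℕ} (i : ℕ) (h : GPLength n (E.augmented.cycles i))
    (hX : ∀ j < n, IsGorensteinProjective (E.complex.X (i + j))) :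
    IsGorensteinProjective (E.augmented.cycles (i + n)) := by
  induction n generalizing i with
  | zero => exact h
  | succ n ih =>
    have := ih (i + 1) (h.syzygy (E.conf_cycles i) (hX 0 n.succ_pos)) fun j hj => by
      rw [add_assoc, add_comm 1]
      exact hX (j + 1) (by lia)
    rwa [add_assoc, add_comm 1] at this

theorem gpLength_iff {n : ℕ} (hX : ∀ i < n, IsGorensteinProjective (E.complex.X i)) :
    GPLength n M ↔ IsGorensteinProjective (E.augmented.cycles n) := by
  obtain ⟨e⟩ := E.nonempty_cycles_zero_equiv
  constructor
  · intro h
    have := E.isGorensteinProjective_cycles 0 (h.congr e) fun j hj => by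
      rw [zero_add]
      exact hX j hj
    rwa [zero_add] at this
  · intro h
    refine (E.gpLength_cycles 0 ?_ fun j hj => ?_).congr e.symm
    · rwa [zero_add]
    · rw [zero_add]
      exact hX j hj

theorem nonempty_X_equiv_cycles {n : ℕ} (h : ∀ i > n, IsZero (E.complex.X i)) :
    Nonempty (E.complex.X n ≃ₗ[A] E.augmented.cycles n) := by
  obtain ⟨f, g, hf, hfg, hg⟩ := E.conf_cycles n
  obtain ⟨f', g', hf', hfg', hg'⟩ := E.conf_cycles (n + 1)
  have := ModuleCat.subsingleton_of_isZero (h (n + 1) n.lt_succ_self)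
  have := hg'.subsingleton
  refine ⟨LinearEquiv.ofBijective g ⟨(injective_iff_map_eq_zero g).2 fun x hx => ?_, hg⟩⟩
  obtain ⟨y, rfl⟩ := (hfg x).1 hx
  rw [Subsingleton.elim y 0, map_zero]

theorem isZero_gpExt_succ_iff (N : ModuleCat.{u} A) (n : ℕ) :
    IsZero (gpExt E N (n + 1)) ↔
      ∀ f : E.augmented.X (n + 2) ⟶ N, E.augmented.d (n + 3) (n + 2) ≫ f = 0 →
        ∃ g : E.augmented.X (n + 1) ⟶ N, E.augmented.d (n + 2) (n + 1) ≫ g = f :=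
  (HomologicalComplex.exactAt_iff_isZero_homology _ _).symm.trans
    (homInto_exactAt_iff (j := n + 1) (i := n + 2) (k := n) E.complex N (by simp) (by simp))

theorem shortExact_cycles (i : ℕ) :
    (ShortComplex.mk (E.augmented.iCycles (i + 1)) (E.augmented.toCycles (i + 1) i)
      (iCycles_toCycles _ _ _)).ShortExact :=
  GorensteinProj.shortExact_cycles E.augmented (i := i + 1) (j := i) rfl (E.acyclic i) _

theorem epi_toCycles (i : ℕ) : Epi (E.augmented.toCycles (i + 1) i) :=
  (E.shortExact_cycles i).epi_g

variable {E}

/-- Properness tested on the syzygy itself lifts its inclusion to a section of the cover, which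
splits the sequence. -/
theorem IsProperGP.exists_retraction (hE : E.IsProperGP) {i : ℕ}
    (h : IsGorensteinProjective (E.augmented.cycles i)) :
    ∃ r : E.augmented.X (i + 1) ⟶ E.augmented.cycles (i + 1),
      E.augmented.iCycles (i + 1) ≫ r = 𝟙 _ := by
  have hS := E.shortExact_cycles i
  -- Truncated subtraction lets `i - 1` serve as the successor degree also for `i = 0`.
  obtain ⟨s, hs⟩ := (homFrom_exactAt_iff (j := i) (i := i + 1) (k := i - 1) _ _ (by simp)
    (by cases i <;> simp)).1 (hE.hom_acyclic _ h i) (E.augmented.iCycles i)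
      (E.augmented.iCycles_d _ _)
  have hs' : s ≫ E.augmented.toCycles (i + 1) i = 𝟙 _ := by
    rw [← cancel_mono (E.augmented.iCycles i), Category.assoc, E.augmented.toCycles_i, hs,
      Category.id_comp]
  exact ⟨_, (ShortComplex.Splitting.ofExactOfSection _ hS.exact s hs' hS.mono_f).f_r⟩

/-- All later syzygies are kernels of epimorphisms between Gorenstein-projectives, so their
sequences split. A cocycle factors through a syzygy and extends along the retraction. -/
theorem IsProperGP.isZero_gpExt (hE : E.IsProperGP) {n : ℕ}
    (h : IsGorensteinProjective (E.augmented.cycles n)) {m : ℕ} (hm : n < m)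
    (N : ModuleCat.{u} A) : IsZero (gpExt E N m) := by
  obtain ⟨k, rfl⟩ := Nat.exists_eq_add_of_lt hm
  have hk : IsGorensteinProjective (E.augmented.cycles (n + k)) := by
    clear hm
    induction k with
    | zero => exact h
    | succ k ih => exact .left (E.conf_cycles (n + k)) (hE.gorensteinProjective _) ih
  obtain ⟨r, hr⟩ := hE.exists_retraction hk
  refine (E.isZero_gpExt_succ_iff N (n + k)).2 fun φ hφ => ?_
  have hepi := E.epi_toCycles (n + k + 2)
  have hφ' : E.augmented.iCycles (n + k + 2) ≫ φ = 0 := by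
    rw [← cancel_epi (E.augmented.toCycles (n + k + 2 + 1) (n + k + 2)), ← Category.assoc,
      E.augmented.toCycles_i, comp_zero]
    exact hφ
  obtain ⟨ψ, hψ⟩ : ∃ ψ, E.augmented.toCycles (n + k + 2) (n + k + 1) ≫ ψ = φ := by
    have := (E.shortExact_cycles (n + k + 1)).epi_g
    obtain ⟨ψ, hψ⟩ := (E.shortExact_cycles (n + k + 1)).exact.desc' φ hφ'
    exact ⟨ψ, hψ⟩
  exact ⟨r ≫ ψ, by rw [← E.augmented.toCycles_i, Category.assoc, reassoc_of% hr, hψ]⟩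

/-- The projection onto the `(n + 1)`-st syzygy is the universal cocycle. Writing it as a coboundary
retracts the inclusion of that syzygy into `E.complex.X n`, leaving the `n`-th syzygy as a summand.
-/
theorem IsProperGP.isGorensteinProjective_cycles (hE : E.IsProperGP) {n : ℕ}
    (h : ∀ N : ModuleCat.{u} A, IsZero (gpExt E N (n + 1))) :
    IsGorensteinProjective (E.augmented.cycles n) := by
  have hS := E.shortExact_cycles n
  have hepi := E.epi_toCycles (n + 1)
  obtain ⟨r, hr⟩ := (E.isZero_gpExt_succ_iff _ n).1 (h (E.augmented.cycles (n + 1)))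
    (E.augmented.toCycles (n + 2) (n + 1)) (E.augmented.d_toCycles _ _ _)
  have hr' : E.augmented.iCycles (n + 1) ≫ r = 𝟙 _ := by
    rw [← cancel_epi (E.augmented.toCycles (n + 1 + 1) (n + 1)), ← Category.assoc,
      E.augmented.toCycles_i, Category.comp_id]
    exact hr
  obtain ⟨e⟩ := nonempty_prod_equiv_of_retraction
    ((ShortComplex.ShortExact.moduleCat_exact_iff_function_exact _).1 hS.exact)
    hS.moduleCat_surjective_g r.hom (congrArg ModuleCat.Hom.hom hr')
  exact .of_prod (Y := E.augmented.cycles (n + 1))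
    ((hE.gorensteinProjective n).congr_equiv (LinearEquiv.prodComm A _ _ ≪≫ₗ e.symm))

theorem IsProperGP.gpLength_iff (hE : E.IsProperGP) (n : ℕ) :
    GPLength n M ↔ ∀ m > n, ∀ N : ModuleCat.{u} A, IsZero (gpExt E N m) := by
  rw [E.gpLength_iff fun i _ => hE.gorensteinProjective i]
  exact ⟨fun h m hm N => hE.isZero_gpExt h hm N,
    fun h => hE.isGorensteinProjective_cycles (h (n + 1) n.lt_succ_self)⟩

end Syzygies

end LeftResolution

/-! ### Dimension and the equivalence -/

theorem gpDim_le_iff (M : ModuleCat.{u} A) (n : ℕ) : gpDim M ≤ n ↔ GPLength n M := by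
  by_cases h : ∃ E : LeftResolution M, E.IsProperGP
  · rw [gpDim, dif_pos h, h.choose_spec.gpLength_iff n, sSup_le_iff]
    constructor
    · intro hle m hm N
      by_contra hN
      exact hm.not_ge (Nat.cast_le.1 (hle m ⟨m, rfl, N, hN⟩))
    · rintro hz _ ⟨m, rfl, N, hN⟩
      exact Nat.cast_le.2 (not_lt.1 fun hm => hN (hz m hm N))
  -- Here the dimension is `⊤`, and a finite Gorenstein-projective length would produce a proper
  -- resolution.
  · rw [gpDim, dif_neg h]
    exact iff_of_false (by simp) fun hM => h (LeftResolution.exists_isProperGP_of_gpLength hM)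

end GorensteinProj

end

theorem mainTheorem7 (R : Type w) [CommRing R] [IsArtinianRing R]
    (A : Type u) [Ring A] [Algebra R A] [Module.Finite R A]
    (M : ModuleCat.{u} A) (n : ℕ) :
    List.TFAE [
      GorensteinProj.gpDim M ≤ (n : ℕ∞),
      -- an exact sequence `0 ⟶ X n ⟶ ⋯ ⟶ X 0 ⟶ M ⟶ 0` with Gorenstein-projective `X i`
      ∃ E : GorensteinProj.LeftResolution M,
        (∀ i ≤ n, GorensteinProj.IsGorensteinProjective (E.complex.X i)) ∧
        (∀ i > n, CategoryTheory.Limits.IsZero (E.complex.X i)),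
      -- exact sequences `0 ⟶ X n ⟶ X (n - 1) ⟶ ⋯ ⟶ X 0 ⟶ M ⟶ 0` with `X i`
      -- Gorenstein-projective for `i < n`; for `n = 0` this is `0 ⟶ X 0 ⟶ M ⟶ 0`
      ∀ E : GorensteinProj.LeftResolution M,
        (∀ i < n, GorensteinProj.IsGorensteinProjective (E.complex.X i)) →
        (∀ i > n, CategoryTheory.Limits.IsZero (E.complex.X i)) →
        GorensteinProj.IsGorensteinProjective (E.complex.X n)] := by
  have h₁ := GorensteinProj.gpDim_le_iff M n
  tfae_have 1 → 3 := by
    intro h E hX hZ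
    obtain ⟨e⟩ := E.nonempty_X_equiv_cycles hZ
    exact ((E.gpLength_iff hX).1 (h₁.1 h)).congr_equiv e
  tfae_have 3 → 2 := by
    intro h
    obtain ⟨E, hX, hZ⟩ := GorensteinProj.LeftResolution.exists_projective_truncation M n
    have hG : ∀ i < n, GorensteinProj.IsGorensteinProjective (E.complex.X i) := fun i hi =>
      have := hX i hi
      GorensteinProj.isGorensteinProjective_of_projective _
    refine ⟨E, fun i hi => ?_, hZ⟩
    obtain hi | rfl := hi.lt_or_eq
    · exact hG i hi
    · exact h E hG hZ
  tfae_have 2 → 1 := by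
    rintro ⟨E, hX, hZ⟩
    obtain ⟨e⟩ := E.nonempty_X_equiv_cycles hZ
    exact h₁.2 ((E.gpLength_iff fun i hi => hX i hi.le).2 ((hX n le_rfl).congr_equiv e.symm))
  tfae_finish
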